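/- An ordered partition of $[n]=\{1,\dots,n\}$ with $k$ blocks is a sequence $B_1/B_2/\cdots/B_k$ of nonempty, pairwise disjoint sets with union $[n]$. It contains the pattern $123$ if there are indices $i_1<i_2<i_3$ and elements $b_1\in B_{i_1}$, $b_2\in B_{i_2}$, $b_3\in B_{i_3}$ with $b_1<b_2<b_3$; otherwise it avoids $123$. Let $op_{n,k}(123)$ be the number of $123$-avoiding ordered partitions of $[n]$ with $k$ blocks. Let $S_n(123)$ be the set of permutations of $[n]$ without an increasing subsequence of length $3$, and for $\sigma\in S_n$ let $\mathrm{des}(\sigma)=|\{i:\sigma_i>\sigma_{i+1}\}|$. Put $$F(x,y)=\sum_{n\ge 0}\sum_{k\ge 0} op_{n,k}(123)\,x^n y^k,\qquad E(x,y)=\sum_{n\ge 0}\sum_{\sigma\in S_n(123)}x^n y^{\mathrm{des}(\sigma)}.$$ **Theorem.** As formal power series in $x$ with coefficients in $\mathbb{Q}((y))$, $$F(x,y)=E(xy,\,1+y^{-1}).$$ Moreover, $$F(x,y)=\frac{-y-2xy-2x+2x^{2}y+2x^{2}+y\sqrt{1-4xy-4x+4x^{2}y+4x^{2}}}{2x(y+1)^{2}(x-1)},$$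 where the square root denotes the unique formal power series in $x$ over $\mathbb{Q}[[y]]$ with constant term $1$ whose square is $1-4xy-4x+4x^2y+4x^2$, and the quotient is taken in the field of fractions of $\mathbb{Q}[[y]][[x]]$. -/

import Mathlib

namespace OrdPart

/-- The sequence `B 0 / B 1 / ⋯ / B (k - 1)` is an ordered partition of the `n`-element
linearly ordered set `Fin n` (standing for `[n]`) into `k` blocks. -/
structure IsOrderedPartition {n k : ℕ} (B : Fin k → Finset (Fin n)) : Prop where
  nonempty : ∀ i, (B i).Nonempty
  disjoint : ∀ i j, i ≠ j → Disjoint (B i) (B j)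
  cover : ∀ a, ∃ i, a ∈ B i

/-- The sequence of blocks `B` contains the pattern `σ`: there are blocks with increasing
indices and one element in each of them, such that these elements form a word that is
order-isomorphic to `σ`. -/
def BlocksContain {n k m : ℕ} (B : Fin k → Finset (Fin n)) (σ : Equiv.Perm (Fin m)) : Prop :=
  ∃ (i : Fin m → Fin k) (b : Fin m → Fin n), StrictMono i ∧ (∀ l, b l ∈ B (i l)) ∧
    ∀ l l', b l < b l' ↔ σ l < σ l'

/-- The permutation `π` of `[n]` contains the pattern `σ`. -/
def PermContains {n m : ℕ} (π : Equiv.Perm (Fin n)) (σ : Equiv.Perm (Fin m)) : Prop :=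
  ∃ i : Fin m → Fin n, StrictMono i ∧ ∀ l l', π (i l) < π (i l') ↔ σ l < σ l'

/-- The pattern `123`, i.e. the identity permutation of three letters. -/
def pattern123 : Equiv.Perm (Fin 3) := 1

/-- The number of ordered partitions of `[n]` with `k` blocks that avoid `σ`. -/
noncomputable def op (n k : ℕ) {m : ℕ} (σ : Equiv.Perm (Fin m)) : ℕ :=
  Set.ncard {B : Fin k → Finset (Fin n) | IsOrderedPartition B ∧ ¬ BlocksContain B σ}

/-- The number of descents of a permutation: positions `i` such that `π i > π (i + 1)`. -/
noncomputable def des {n : ℕ} (π : Equiv.Perm (Fin n)) : ℕ :=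
  Set.ncard {i : Fin n | ∃ j : Fin n, (j : ℕ) = i + 1 ∧ π j < π i}

/-- The number of `123`-avoiding permutations of `[n]` with exactly `d` descents. -/
noncomputable def e (n d : ℕ) : ℕ :=
  Set.ncard {π : Equiv.Perm (Fin n) | ¬ PermContains π pattern123 ∧ des π = d}

/-- The bivariate generating function `F(x, y) = ∑ₙ ∑ₖ op n k (123) xⁿ yᵏ` as a power series
in `x` (the outer variable) over power series in `y` (the inner variable). -/
noncomputable def F : PowerSeries (PowerSeries ℚ) :=
  PowerSeries.mk fun n => PowerSeries.mk fun k => (op n k pattern123 : ℚ)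

open Classical in
/-- The bivariate generating function `E(x, y) = ∑ₙ ∑_π xⁿ y ^ des π`, the inner sum over the
`123`-avoiding permutations `π` of `[n]`, as a power series in `x` over polynomials in `y`. -/
noncomputable def E : PowerSeries (Polynomial ℚ) :=
  PowerSeries.mk fun n =>
    ∑ π : Equiv.Perm (Fin n) with ¬ PermContains π pattern123, (Polynomial.X : Polynomial ℚ) ^ des π

theorem coeff_coeff_E (n d : ℕ) : (PowerSeries.coeff n E).coeff d = (e n d : ℚ) := by
  classical
  simp only [E, e, PowerSeries.coeff_mk, Polynomial.finsetSum_coeff, Polynomial.coeff_X_pow]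
  rw [Finset.sum_boole, Set.ncard_eq_toFinset_card', Finset.filter_filter]
  congr 2
  ext π
  simp [eq_comm]

/-- The substitution `G(a x, b)`, for a power series `G(x, y)` in `x` whose coefficients are
polynomials in `y`, and elements `a`, `b` of a commutative ℚ-algebra `K`. -/
noncomputable def substAt {K : Type*} [CommRing K] [Algebra ℚ K]
    (G : PowerSeries (Polynomial ℚ)) (a b : K) : PowerSeries K :=
  PowerSeries.rescale a (PowerSeries.map (Polynomial.aeval b : Polynomial ℚ →ₐ[ℚ] K).toRingHom G)

/-- The variable `y` as an element of the field `ℚ((y))`. -/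
noncomputable def yL : LaurentSeries ℚ := HahnSeries.single 1 1

/-- A series in `ℚ[[y]][[x]]` viewed in `ℚ((y))[[x]]`. -/
noncomputable def toLaurent : PowerSeries (PowerSeries ℚ) →+* PowerSeries (LaurentSeries ℚ) :=
  PowerSeries.map (HahnSeries.ofPowerSeries ℤ ℚ)

/-- The variable `x` of `ℚ[[y]][[x]]`. -/
noncomputable def x : PowerSeries (PowerSeries ℚ) := PowerSeries.X

/-- The variable `y` of `ℚ[[y]][[x]]`. -/
noncomputable def y : PowerSeries (PowerSeries ℚ) := PowerSeries.C PowerSeries.X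

/-- `S` is the formal square root of `P`: the power series with constant term (in `x`) equal
to `1` whose square is `P`. -/
def IsFormalSqrt (P S : PowerSeries (PowerSeries ℚ)) : Prop :=
  PowerSeries.constantCoeff S = 1 ∧ S ^ 2 = P

/-- The embedding of `ℚ[[y]][[x]]` in its field of fractions. -/
noncomputable def toFrac :
    PowerSeries (PowerSeries ℚ) →+* FractionRing (PowerSeries (PowerSeries ℚ)) :=
  algebraMap _ _

end OrdPart

-- Growing 123-avoiding permutations by appending a last letter

namespace OrdPart

open Finset

-- List every block in decreasing order and concatenate. The resulting permutation avoids 123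
-- exactly when the ordered partition does (`Sorts.avoids_iff`). The partitions with k blocks that
-- give a fixed π correspond to the choices of n - k descents of π lying inside blocks
-- (`ncard_sorts`). With d = des π, the contribution of π is thus ∑ C(d, n - k) y^k = y^(n-d) (1 +
-- y)^d = y^n (1 + 1/y)^d, which is F(x, y) = E(xy, 1 + 1/y).
--
-- For the closed form, 123-avoiding permutations are grown by appending letters. The admissible
-- letters form an initial segment; its length `sites`, together with whether the last letter is the
-- smallest, governs all further growth and descents (`sum_ext_append`). Weighing descents by s = y
-- + 1 and other letters by t = y gives functional equations indexed by the number m of sites. They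
-- are solved in `mk_extB_two` by powers of the root U of U = 1 + x s (1 - x) U², whose discriminant
-- is the radicand of the theorem.

theorem permContains_pattern123 {n : ℕ} {π : Equiv.Perm (Fin n)} :
    PermContains π pattern123 ↔ ∃ i j k, i < j ∧ j < k ∧ π i < π j ∧ π j < π k := by
  constructor
  · rintro ⟨i, hi, h⟩
    refine ⟨i 0, i 1, i 2, hi (by decide), hi (by decide), (h 0 1).2 ?_, (h 1 2).2 ?_⟩ <;>
      simp [pattern123]
  · rintro ⟨i, j, k, hij, hjk, h1, h2⟩
    have hs : StrictMono ![i, j, k] := by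
      intro a b hab
      fin_cases a <;> fin_cases b <;> simp_all; exact hij.trans hjk
    have hs' : StrictMono (π ∘ ![i, j, k]) := by
      intro a b hab
      fin_cases a <;> fin_cases b <;> simp_all; exact h1.trans h2
    exact ⟨![i, j, k], hs, fun l l' => by simpa [pattern123] using hs'.lt_iff_lt (a := l) (b := l')⟩

/-- The permutation obtained by appending the letter `v` to `π`, after raising by one the
letters of `π` that are at least `v`. -/
def appendFun {n : ℕ} (v : Fin (n + 1)) (π : Equiv.Perm (Fin n)) : Fin (n + 1) → Fin (n + 1) :=
  Fin.lastCases v fun i => v.succAbove (π i)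

@[simp] theorem appendFun_last {n : ℕ} (v : Fin (n + 1)) (π : Equiv.Perm (Fin n)) :
    appendFun v π (Fin.last n) = v := by simp [appendFun]

@[simp] theorem appendFun_castSucc {n : ℕ} (v : Fin (n + 1)) (π : Equiv.Perm (Fin n))
    (i : Fin n) : appendFun v π i.castSucc = v.succAbove (π i) := by simp [appendFun]

theorem appendFun_injective {n : ℕ} (v : Fin (n + 1)) (π : Equiv.Perm (Fin n)) :
    Function.Injective (appendFun v π) := by
  intro a b
  induction a using Fin.lastCases <;> induction b using Fin.lastCases <;>
    simp [Fin.succAbove_ne, (Fin.succAbove_ne _ _).symm]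

/-- `appendFun v π` as a permutation. -/
noncomputable def append {n : ℕ} (v : Fin (n + 1)) (π : Equiv.Perm (Fin n)) :
    Equiv.Perm (Fin (n + 1)) :=
  Equiv.ofBijective _ (Finite.injective_iff_bijective.1 (appendFun_injective v π))

@[simp] theorem append_last {n : ℕ} (v : Fin (n + 1)) (π : Equiv.Perm (Fin n)) :
    append v π (Fin.last n) = v := appendFun_last v π

@[simp] theorem append_castSucc {n : ℕ} (v : Fin (n + 1)) (π : Equiv.Perm (Fin n))
    (i : Fin n) : append v π i.castSucc = v.succAbove (π i) := appendFun_castSucc v π i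

theorem append_bijective (n : ℕ) : Function.Bijective
    fun p : Fin (n + 1) × Equiv.Perm (Fin n) => append p.1 p.2 := by
  rw [Fintype.bijective_iff_injective_and_card]
  constructor
  · rintro ⟨v, π⟩ ⟨w, τ⟩ h
    have hv : v = w := by simpa using DFunLike.congr_fun h (Fin.last n)
    subst hv
    congr 1
    ext i : 1
    simpa using DFunLike.congr_fun h i.castSucc
  · simp [Fintype.card_perm, Nat.factorial_succ]

theorem sum_perm_succ {n : ℕ} {M : Type*} [AddCommMonoid M] (f : Equiv.Perm (Fin (n + 1)) → M) :
    ∑ π, f π = ∑ π : Equiv.Perm (Fin n), ∑ v : Fin (n + 1), f (append v π) := by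
  rw [← (append_bijective n).sum_comp, Fintype.sum_prod_type_right]

/-- Some ascending pair of letters of `π` has its larger letter below `c`, or `c` exceeds `n`. -/
def HasAscentBelow {n : ℕ} (π : Equiv.Perm (Fin n)) (c : ℕ) : Prop :=
  n < c ∨ ∃ i j, i < j ∧ π i < π j ∧ (π j : ℕ) < c

theorem exists_hasAscentBelow {n : ℕ} (π : Equiv.Perm (Fin n)) : ∃ c, HasAscentBelow π c :=
  ⟨n + 1, .inl n.lt_succ_self⟩

open Classical in
/-- The number of letters that can be appended to a `123`-avoiding permutation `π` without
creating the pattern. -/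
noncomputable def sites {n : ℕ} (π : Equiv.Perm (Fin n)) : ℕ :=
  Nat.find (exists_hasAscentBelow π)

theorem sites_le_iff {n : ℕ} {π : Equiv.Perm (Fin n)} {c : ℕ} :
    sites π ≤ c ↔ HasAscentBelow π c := by
  classical
  rw [sites, Nat.find_le_iff]
  refine ⟨?_, fun h => ⟨c, le_rfl, h⟩⟩
  rintro ⟨m, hm, h | ⟨i, j, hij, h1, h2⟩⟩
  · exact .inl (h.trans_le hm)
  · exact .inr ⟨i, j, hij, h1, h2.trans_le hm⟩

theorem sites_eq {n : ℕ} {π : Equiv.Perm (Fin n)} {m : ℕ}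
    (h : ∀ c, HasAscentBelow π c ↔ m ≤ c) : sites π = m :=
  eq_of_forall_ge_iff fun c => by rw [sites_le_iff, h]

theorem one_le_sites {n : ℕ} (π : Equiv.Perm (Fin n)) : 1 ≤ sites π := by
  by_contra! h
  rcases sites_le_iff.1 (Nat.lt_succ_iff.1 h) with h | ⟨_, _, _, _, h⟩ <;> omega

theorem sites_le {n : ℕ} (π : Equiv.Perm (Fin n)) : sites π ≤ n + 1 :=
  sites_le_iff.2 (.inl n.lt_succ_self)

/-- A new occurrence must use v as its largest letter, above an ascending pair of π. Letters at
least v are raised past v, so the comparison with v can be made on the original letters. -/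
theorem permContains_append {n : ℕ} {v : Fin (n + 1)} {π : Equiv.Perm (Fin n)} :
    PermContains (append v π) pattern123 ↔ PermContains π pattern123 ∨ sites π ≤ v := by
  rw [permContains_pattern123, permContains_pattern123, sites_le_iff, HasAscentBelow]
  constructor
  · rintro ⟨i, j, k, hij, hjk, h1, h2⟩
    induction j using Fin.lastCases with
    | last => exact absurd hjk (Fin.le_last k).not_gt
    | cast j =>
    induction i using Fin.lastCases with
    | last => exact absurd hij (Fin.le_last _).not_gt
    | cast i =>
    have h1' : π i < π j := by simpa using h1
    induction k using Fin.lastCases with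
    | last =>
      refine .inr (.inr ⟨i, j, by simpa using hij, h1', ?_⟩)
      rw [append_castSucc, append_last, Fin.succAbove_lt_iff_castSucc_lt] at h2
      exact h2
    | cast k =>
      exact .inl ⟨i, j, k, by simpa using hij, by simpa using hjk, h1', by simpa using h2⟩
  · rintro (⟨i, j, k, hij, hjk, h1, h2⟩ | h | ⟨i, j, hij, h1, h2⟩)
    · exact ⟨i.castSucc, j.castSucc, k.castSucc, by simpa, by simpa, by simpa, by simpa⟩
    · omega
    · refine ⟨i.castSucc, j.castSucc, Fin.last n, by simpa, Fin.castSucc_lt_last j, by simpa, ?_⟩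
      rw [append_castSucc, append_last, Fin.succAbove_lt_iff_castSucc_lt]
      exact h2

/-- A final 0 ends no ascending pair and raises every other letter by one, so the threshold moves by
one. -/
theorem sites_append_zero {n : ℕ} (π : Equiv.Perm (Fin n)) :
    sites (append 0 π) = sites π + 1 := by
  refine sites_eq fun c => ?_
  constructor
  · rintro (h | ⟨i, j, hij, h1, h2⟩)
    · have := sites_le π
      omega
    · induction j using Fin.lastCases with
      | last => simp at h1
      | cast j =>
      induction i using Fin.lastCases with
      | last => exact absurd hij (Fin.le_last _).not_gt
      | cast i =>
      simp only [append_castSucc, Fin.zero_succAbove, Fin.val_succ] at h2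
      have : sites π ≤ c - 1 := sites_le_iff.2
        (.inr ⟨i, j, by simpa using hij, by simpa using h1, by omega⟩)
      omega
  · intro h
    obtain ⟨c, rfl⟩ : ∃ d, c = d + 1 := ⟨c - 1, by omega⟩
    rcases sites_le_iff.1 (Nat.le_of_succ_le_succ h) with h | ⟨i, j, hij, h1, h2⟩
    · exact .inl (by omega)
    · exact .inr ⟨i.castSucc, j.castSucc, by simpa, by simpa, by simpa⟩

/-- The letter 0 stands before the last letter and forms an ascending pair with it; avoidance
forbids an ascending pair with a smaller top. -/
theorem sites_of_last_ne_zero {n : ℕ} {π : Equiv.Perm (Fin (n + 1))}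
    (hπ : ¬ PermContains π pattern123) (h0 : π (Fin.last n) ≠ 0) :
    sites π = π (Fin.last n) + 1 := by
  refine sites_eq fun c => ?_
  constructor
  · rintro (h | ⟨i, j, hij, h1, h2⟩)
    · omega
    · by_contra! hc
      refine hπ (permContains_pattern123.2 ⟨i, j, Fin.last n, hij, ?_, h1, ?_⟩)
      · refine lt_of_le_of_ne (Fin.le_last j) ?_
        rintro rfl
        omega
      · rw [Fin.lt_def]
        omega
  · intro h
    refine .inr ⟨π.symm 0, Fin.last n, ?_, ?_, by omega⟩
    · refine lt_of_le_of_ne (Fin.le_last _) ?_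
      intro h
      apply h0
      rw [← h, Equiv.apply_symm_apply]
    · simpa using Fin.pos_iff_ne_zero.2 h0

theorem des_append {n : ℕ} (v : Fin (n + 2)) (π : Equiv.Perm (Fin (n + 1))) :
    des (append v π) = des π + if (v : ℕ) ≤ π (Fin.last n) then 1 else 0 := by
  have key : {i : Fin (n + 2) | ∃ j : Fin (n + 2), (j : ℕ) = i + 1 ∧ append v π j < append v π i} =
      Fin.castSucc '' {i : Fin (n + 1) | ∃ j : Fin (n + 1), (j : ℕ) = i + 1 ∧ π j < π i} ∪
        if (v : ℕ) ≤ π (Fin.last n) then {(Fin.last n).castSucc} else ∅ := by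
    ext i
    simp only [Set.mem_ofPred_eq, Set.mem_union, Set.mem_image]
    constructor
    · rintro ⟨j, hj, h⟩
      induction i using Fin.lastCases with
      | last => simp at hj; omega
      | cast i =>
      induction j using Fin.lastCases with
      | last =>
        have hi : i = Fin.last n := by
          ext; simpa using hj.symm
        subst hi
        rw [append_castSucc, append_last, Fin.lt_succAbove_iff_le_castSucc] at h
        right
        rw [if_pos (by simpa [Fin.le_def] using h)]
        rfl
      | cast j =>
        exact .inl ⟨i, ⟨j, by simpa using hj, by simpa using h⟩, rfl⟩
    · rintro (⟨i, ⟨j, hj, h⟩, rfl⟩ | h)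
      · exact ⟨j.castSucc, by simpa, by simpa⟩
      · split_ifs at h with hv
        · obtain rfl : i = (Fin.last n).castSucc := h
          refine ⟨Fin.last _, by simp, ?_⟩
          rw [append_castSucc, append_last, Fin.lt_succAbove_iff_le_castSucc]
          simpa [Fin.le_def] using hv
        · exact h.elim
  rw [des, key, Set.ncard_union_eq, Set.ncard_image_of_injective _ (Fin.castSucc_injective _)]
  · split_ifs <;> simp [des]
  · rw [Set.disjoint_left]
    rintro _ ⟨i, ⟨j, hj, -⟩, rfl⟩ h
    split_ifs at h
    · have : i = Fin.last n := Fin.castSucc_injective _ h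
      subst this
      simp at hj
      omega
    · exact h

theorem des_le {n : ℕ} (π : Equiv.Perm (Fin n)) : des π ≤ n := by
  simpa only [des, Nat.card_fin] using
    Set.ncard_le_card {i : Fin n | ∃ j : Fin n, (j : ℕ) = i + 1 ∧ π j < π i}

-- Weighted enumeration along the generating tree

variable {R : Type*} [CommSemiring R]

mutual
/-- The weight of all ways to append `k` letters to a `123`-avoiding permutation with `m` sites
whose last letter is not the smallest; a descent weighs `s` and any other letter `t`. -/
def extA (s t : R) : ℕ → ℕ → R
  | 0, _ => 1
  | k + 1, m => s * extB s t k (m + 1) + s * ∑ v ∈ Ico 1 m, extA s t k (v + 1)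
/-- The weight of all ways to append `k` letters to a `123`-avoiding permutation with `m` sites
whose last letter is the smallest; a descent weighs `s` and any other letter `t`. -/
def extB (s t : R) : ℕ → ℕ → R
  | 0, _ => 1
  | k + 1, m => s * extB s t k (m + 1) + t * ∑ v ∈ Ico 1 m, extA s t k (v + 1)
end

/-- The weight of a permutation: a factor `s` for each descent, `t` for each other letter. -/
noncomputable def weight (s t : R) {n : ℕ} (π : Equiv.Perm (Fin n)) : R :=
  t ^ (n - des π) * s ^ des π

/-- The weight of all ways to append `k` letters to `π`. -/
noncomputable def ext (s t : R) (k : ℕ) {n : ℕ} (π : Equiv.Perm (Fin (n + 1))) : R :=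
  if π (Fin.last n) = 0 then extB s t k (sites π) else extA s t k (sites π)

theorem weight_append (s t : R) {n : ℕ} (v : Fin (n + 2)) (π : Equiv.Perm (Fin (n + 1))) :
    weight s t (append v π) =
      weight s t π * if (v : ℕ) ≤ π (Fin.last n) then s else t := by
  have := des_le π
  rw [weight, weight, des_append]
  split_ifs
  · rw [Nat.add_sub_add_right, pow_succ]; ring
  · rw [add_zero, Nat.succ_sub this, pow_succ]; ring

theorem sum_fin_lt {n m : ℕ} (hm : m ≤ n) (f : ℕ → R) :
    ∑ v : Fin n, (if (v : ℕ) < m then f v else 0) = ∑ v ∈ range m, f v := by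
  rw [Fin.sum_univ_eq_sum_range (fun v => if v < m then f v else 0), ← sum_filter]
  congr 1
  ext v
  simp only [mem_filter, mem_range]
  omega

-- If the last letter is nonzero, `sites` exceeds it by one, so every admissible letter makes a
-- descent. If it is 0, only appending 0 does. This is the difference between `extA` and `extB`.
open Classical in
theorem sum_ext_append (s t : R) (k : ℕ) {n : ℕ} {π : Equiv.Perm (Fin (n + 1))}
    (hπ : ¬ PermContains π pattern123) :
    ∑ v : Fin (n + 2), (if ¬ PermContains (append v π) pattern123 then
      weight s t (append v π) * ext s t k (append v π) else 0) =
      weight s t π * ext s t (k + 1) π := by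
  have hterm : ∀ v : Fin (n + 2), (if ¬ PermContains (append v π) pattern123 then
      weight s t (append v π) * ext s t k (append v π) else 0) =
      if (v : ℕ) < sites π then (fun v : ℕ => weight s t π *
        ((if v ≤ π (Fin.last n) then s else t) *
          if v = 0 then extB s t k (sites π + 1) else extA s t k (v + 1))) v else 0 := by
    intro v
    by_cases hv : (v : ℕ) < sites π
    · have hc : ¬ PermContains (append v π) pattern123 := by
        rw [permContains_append]
        push Not
        exact ⟨hπ, hv⟩
      rw [if_pos hc, if_pos hv, weight_append, mul_assoc]
      congr 2
      rw [ext, append_last]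
      by_cases h0 : v = 0
      · subst h0
        simp [sites_append_zero]
      · rw [if_neg h0, if_neg (fun h : (v : ℕ) = 0 => h0 (Fin.ext h)),
          sites_of_last_ne_zero hc (by simpa using h0), append_last]
    · rw [if_neg (by rw [permContains_append]; exact not_not.2 (.inr (not_lt.1 hv))), if_neg hv]
  have h1 := one_le_sites π
  rw [sum_congr rfl fun v _ => hterm v, sum_fin_lt (sites_le π) fun v : ℕ => weight s t π *
        ((if v ≤ π (Fin.last n) then s else t) *
          if v = 0 then extB s t k (sites π + 1) else extA s t k (v + 1)), ← mul_sum, range_eq_Ico,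
    sum_eq_sum_Ico_succ_bot h1]
  congr 1
  rw [ext]
  have hI : ∀ w : R, (∀ v ∈ Ico 1 (sites π), (if v ≤ (π (Fin.last n) : ℕ) then s else t) = w) →
      ∑ v ∈ Ico (0 + 1) (sites π), ((if v ≤ (π (Fin.last n) : ℕ) then s else t) *
        if v = 0 then extB s t k (sites π + 1) else extA s t k (v + 1)) =
      w * ∑ v ∈ Ico 1 (sites π), extA s t k (v + 1) := by
    intro w hw
    rw [mul_sum, zero_add]
    refine sum_congr rfl fun v hv => ?_
    rw [hw v hv, if_neg (by have := mem_Ico.1 hv; omega)]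
  by_cases h0 : π (Fin.last n) = 0
  · rw [if_pos h0, extB, hI t fun v hv => if_neg (by have := mem_Ico.1 hv; simp [h0]; omega)]
    simp
  · rw [if_neg h0, extA, hI s fun v hv => if_pos (by
      have := mem_Ico.1 hv
      rw [sites_of_last_ne_zero hπ h0] at this
      omega)]
    simp

-- Each induction step trades one letter already placed for one still to be appended, hence the
-- generality in k. The base is the single letter: weight t, last letter smallest, two sites.
open Classical in
theorem sum_weight_ext (s t : R) (n k : ℕ) :
    ∑ π : Equiv.Perm (Fin (n + 1)) with ¬ PermContains π pattern123,
      weight s t π * ext s t k π = t * extB s t (n + k) 2 := by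
  induction n generalizing k with
  | zero =>
    have hc (π : Equiv.Perm (Fin 1)) : ¬ PermContains π pattern123 := by
      rw [permContains_pattern123]
      rintro ⟨i, j, k, h, -⟩
      omega
    have hd (π : Equiv.Perm (Fin 1)) : des π = 0 := by
      rw [des, Set.ncard_eq_zero]
      ext i
      simp only [Set.mem_ofPred_eq, Set.mem_empty_iff_false, iff_false]
      rintro ⟨j, hj, -⟩
      omega
    have hs (π : Equiv.Perm (Fin 1)) : sites π = 2 := sites_eq fun c => by
      constructor
      · rintro (h | ⟨i, j, h, -⟩) <;> omega
      · exact fun h => .inl h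
    simp [hc, hd, hs, weight, ext, Fin.eq_zero]
  | succ n ih =>
    have hk : n + 1 + k = n + (k + 1) := by omega
    rw [congrArg (extB s t · 2) hk, ← ih, sum_filter, sum_filter, sum_perm_succ]
    refine sum_congr rfl fun π _ => ?_
    split_ifs with hπ
    · refine sum_eq_zero fun v _ => if_neg ?_
      rw [permContains_append]
      exact not_not.2 (.inl hπ)
    · exact sum_ext_append s t k hπ

open Classical in
theorem sum_weight (s t : R) (n : ℕ) :
    ∑ π : Equiv.Perm (Fin (n + 1)) with ¬ PermContains π pattern123, weight s t π =
      t * extB s t n 2 := by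
  have := sum_weight_ext s t n 0
  simpa [ext, extA, extB] using this

end OrdPart

-- Ordered partitions as permutations with marked descents

namespace OrdPart

open Finset

section Words

variable {n k : ℕ}

/-- The sequence of blocks in which the block of `a` is the one with index `g a`. -/
def blocks (g : Fin n → Fin k) (i : Fin k) : Finset (Fin n) := {a | g a = i}

@[simp] theorem mem_blocks {g : Fin n → Fin k} {i : Fin k} {a : Fin n} :
    a ∈ blocks g i ↔ g a = i := by simp [blocks]

theorem blocks_injective : Function.Injective (blocks : (Fin n → Fin k) → _) := by
  intro g h hgh
  ext1 a
  have : a ∈ blocks g (g a) := mem_blocks.2 rfl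
  rw [hgh, mem_blocks] at this
  exact this.symm

theorem isOrderedPartition_iff {B : Fin k → Finset (Fin n)} :
    IsOrderedPartition B ↔ ∃ g : Fin n → Fin k, Function.Surjective g ∧ blocks g = B := by
  constructor
  · rintro ⟨h1, h2, h3⟩
    choose g hg using h3
    have hB (a i) : a ∈ B i ↔ g a = i := by
      refine ⟨fun h => ?_, fun h => h ▸ hg a⟩
      by_contra hne
      exact disjoint_left.1 (h2 _ _ hne) (hg a) h
    refine ⟨g, fun i => ?_, ?_⟩
    · obtain ⟨a, ha⟩ := h1 i
      exact ⟨a, (hB a i).1 ha⟩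
    · ext i a
      rw [mem_blocks, hB]
  · rintro ⟨g, hg, rfl⟩
    refine ⟨fun i => ?_, fun i j hij => ?_, fun a => ⟨g a, mem_blocks.2 rfl⟩⟩
    · obtain ⟨a, ha⟩ := hg i
      exact ⟨a, mem_blocks.2 ha⟩
    · rw [disjoint_left]
      intro a hi hj
      exact hij ((mem_blocks.1 hi).symm.trans (mem_blocks.1 hj))

theorem blocksContain_blocks {g : Fin n → Fin k} :
    BlocksContain (blocks g) pattern123 ↔
      ∃ a b c, a < b ∧ b < c ∧ g a < g b ∧ g b < g c := by
  constructor
  · rintro ⟨i, b, hi, hb, h⟩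
    simp only [mem_blocks] at hb
    refine ⟨b 0, b 1, b 2, (h 0 1).2 ?_, (h 1 2).2 ?_, ?_, ?_⟩
    · simp [pattern123]
    · simp [pattern123]
    · rw [hb, hb]; exact hi (by decide)
    · rw [hb, hb]; exact hi (by decide)
  · rintro ⟨a, b, c, hab, hbc, h1, h2⟩
    have hs : StrictMono ![a, b, c] := by
      intro i j hij
      fin_cases i <;> fin_cases j <;> simp_all; exact hab.trans hbc
    have hs' : StrictMono (g ∘ ![a, b, c]) := by
      intro i j hij
      fin_cases i <;> fin_cases j <;> simp_all; exact h1.trans h2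
    exact ⟨g ∘ ![a, b, c], ![a, b, c], hs', fun l => mem_blocks.2 rfl,
      fun l l' => by simpa [pattern123] using hs.lt_iff_lt (a := l) (b := l')⟩

theorem op_eq_ncard (n k : ℕ) : op n k pattern123 = Set.ncard {g : Fin n → Fin k |
    Function.Surjective g ∧ ¬ ∃ a b c, a < b ∧ b < c ∧ g a < g b ∧ g b < g c} := by
  rw [op, ← Set.ncard_image_of_injective _ blocks_injective]
  congr 1
  ext B
  simp only [Set.mem_ofPred_eq, Set.mem_image, isOrderedPartition_iff]
  constructor
  · rintro ⟨⟨g, hg, rfl⟩, h⟩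
    exact ⟨g, ⟨hg, by rwa [blocksContain_blocks] at h⟩, rfl⟩
  · rintro ⟨g, ⟨hg, h⟩, rfl⟩
    exact ⟨⟨g, hg, rfl⟩, by rwa [blocksContain_blocks]⟩

/-- `π` lists the letters of `Fin n` by increasing value of `g`, and letters with the same value
of `g` in decreasing order. -/
def Sorts (π : Equiv.Perm (Fin n)) (g : Fin n → Fin k) : Prop :=
  Monotone (g ∘ π) ∧ ∀ i j, i < j → g (π i) = g (π j) → π j < π i

/-- `Tuple.sort` breaks ties in increasing order; reversing the alphabet makes ties decreasing. So
each g is sorted by exactly one π. -/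
theorem sorts_iff {π : Equiv.Perm (Fin n)} {g : Fin n → Fin k} :
    Sorts π g ↔ π = Fin.revPerm * Tuple.sort (g ∘ Fin.rev) := by
  have : π = Fin.revPerm * Tuple.sort (g ∘ Fin.rev) ↔
      Fin.revPerm * π = Tuple.sort (g ∘ Fin.rev) := by
    rw [← inv_mul_eq_iff_eq_mul]
    rfl
  rw [this, Tuple.eq_sort_iff, Sorts]
  simp [Function.comp_def]

/-- Letters of one block appear in decreasing order, so an increasing subsequence of π takes its
letters from distinct blocks. -/
theorem Sorts.avoids_iff {π : Equiv.Perm (Fin n)} {g : Fin n → Fin k} (h : Sorts π g) :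
    (∃ a b c, a < b ∧ b < c ∧ g a < g b ∧ g b < g c) ↔ PermContains π pattern123 := by
  rw [permContains_pattern123]
  constructor
  · rintro ⟨a, b, c, hab, hbc, h1, h2⟩
    refine ⟨π.symm a, π.symm b, π.symm c, h.1.reflect_lt ?_, h.1.reflect_lt ?_, ?_, ?_⟩ <;>
      simpa
  · rintro ⟨i, j, l, hij, hjl, h1, h2⟩
    exact ⟨π i, π j, π l, h1, h2,
      (h.1 hij.le).lt_of_ne fun he => (h.2 i j hij he).not_gt h1,
      (h.1 hjl.le).lt_of_ne fun he => (h.2 j l hjl he).not_gt h2⟩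

/-- The positions at which the next letter of the word `w` is the same. -/
def plateaus {α : Type*} [DecidableEq α] (w : Fin n → α) : Finset (Fin n) :=
  {i | ∃ j : Fin n, (j : ℕ) = i + 1 ∧ w j = w i}

theorem lt_of_notMem_plateaus {w : Fin n → Fin k} (hw : Monotone w) {a b : Fin n}
    (ha : a ∉ plateaus w) (hab : a < b) : w a < w b := by
  have hb : (a : ℕ) + 1 < n := by omega
  have h1 : w ⟨a + 1, hb⟩ ≠ w a := fun h => ha (by
    rw [plateaus, mem_filter_univ]
    exact ⟨_, rfl, h⟩)
  refine ((hw ?_).lt_of_ne' h1).trans_le (hw ?_) <;> simp only [Fin.le_def] <;> omega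

theorem exists_notMem_plateaus {w : Fin n → Fin k}
    (hs : Function.Surjective w) (v : Fin k) : ∃ a ∉ plateaus w, w a = v := by
  obtain ⟨a₀, ha₀⟩ := hs v
  obtain ⟨a, ha, hmax⟩ := exists_max_image ({a | w a = v} : Finset (Fin n)) id ⟨a₀, by simpa⟩
  simp only [mem_filter_univ, id] at ha hmax
  refine ⟨a, fun h => ?_, ha⟩
  rw [plateaus, mem_filter_univ] at h
  obtain ⟨j, hj, h⟩ := h
  have := hmax j (h.trans ha)
  omega

theorem injOn_compl_plateaus {w : Fin n → Fin k} (hw : Monotone w) :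
    Set.InjOn w ((plateaus w)ᶜ : Finset (Fin n)) := by
  intro a ha b hb h
  simp only [coe_compl, Set.mem_compl_iff, mem_coe] at ha hb
  rcases lt_trichotomy a b with hab | hab | hab
  · exact absurd h (lt_of_notMem_plateaus hw ha hab).ne
  · exact hab
  · exact absurd h (lt_of_notMem_plateaus hw hb hab).ne'

theorem card_compl_plateaus {w : Fin n → Fin k} (hw : Monotone w)
    (hs : Function.Surjective w) : #(plateaus w)ᶜ = k := by
  have : (plateaus w)ᶜ.image w = univ := eq_univ_of_forall fun v => by
    obtain ⟨a, ha, hv⟩ := exists_notMem_plateaus hs v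
    exact mem_image.2 ⟨a, mem_compl.2 ha, hv⟩
  rw [← card_image_of_injOn (injOn_compl_plateaus hw), this, card_fin]

/-- A monotone surjective word rises by exactly one after each position that is not a plateau, so
its plateaus determine it. -/
theorem val_eq_card_filter {w : Fin n → Fin k} (hw : Monotone w)
    (hs : Function.Surjective w) (i : Fin n) :
    (w i : ℕ) = #{a ∈ (plateaus w)ᶜ | a < i} := by
  rw [← card_image_of_injOn ((injOn_compl_plateaus hw).mono (filter_subset _ _)),
    ← Fin.card_Iio]
  congr 1
  ext v
  simp only [mem_Iio, mem_image, mem_filter, mem_compl]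
  constructor
  · intro hv
    obtain ⟨a, ha, rfl⟩ := exists_notMem_plateaus hs v
    exact ⟨a, ⟨ha, hw.reflect_lt hv⟩, rfl⟩
  · rintro ⟨a, ⟨ha, hai⟩, rfl⟩
    exact lt_of_notMem_plateaus hw ha hai

/-- A set of positions without the last one is the set of plateaus of a monotone word. -/
theorem exists_plateaus_eq {S : Finset (Fin n)} (hS : ∀ i ∈ S, (i : ℕ) + 1 < n)
    (hk : #Sᶜ = k) :
    ∃ w : Fin n → Fin k, Monotone w ∧ Function.Surjective w ∧ plateaus w = S := by
  have hlt (i : Fin n) : #{a ∈ Sᶜ | a < i} < k := by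
    have := i.isLt
    rw [← hk]
    -- The last position lies outside S and is below no position, so the count is strictly less than
    -- k.
    refine card_lt_card ((filter_ssubset).2 ⟨⟨n - 1, by omega⟩, ?_, ?_⟩)
    · rw [mem_compl]
      intro h
      have := hS _ h
      simp at this
      omega
    · simp only [Fin.lt_def]
      omega
  let w : Fin n → Fin k := fun i => ⟨#{a ∈ Sᶜ | a < i}, hlt i⟩
  have hmono : Monotone w := fun i j hij => by
    refine card_le_card fun a => ?_
    simp only [mem_filter]
    exact fun h => ⟨h.1, h.2.trans_le hij⟩
  have hstrict {i j : Fin n} (hi : i ∉ S) (hij : i < j) : w i < w j := by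
    refine card_lt_card ((ssubset_iff_of_subset fun a => ?_).2 ⟨i, ?_, ?_⟩)
    · simp only [mem_filter]
      exact fun h => ⟨h.1, h.2.trans hij⟩
    · simp [hi, hij]
    · simp
  refine ⟨w, hmono, ?_, ?_⟩
  · have hinj : Set.InjOn w (Sᶜ : Finset (Fin n)) := by
      intro a ha b hb h
      simp only [coe_compl, Set.mem_compl_iff, mem_coe] at ha hb
      rcases lt_trichotomy a b with hab | hab | hab
      · exact absurd h (hstrict ha hab).ne
      · exact hab
      · exact absurd h (hstrict hb hab).ne'
    have : Sᶜ.image w = univ := by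
      rw [← card_eq_iff_eq_univ, card_image_of_injOn hinj, hk, Fintype.card_fin]
    intro v
    obtain ⟨a, -, ha⟩ := mem_image.1 (this ▸ mem_univ v)
    exact ⟨a, ha⟩
  · ext i
    rw [plateaus, mem_filter_univ]
    constructor
    · rintro ⟨j, hj, h⟩
      by_contra hi
      exact (hstrict hi (by rw [Fin.lt_def]; omega)).ne' h
    · intro hi
      refine ⟨⟨i + 1, hS i hi⟩, rfl, ?_⟩
      simp only [w, Fin.mk.injEq]
      congr 1
      ext a
      simp only [mem_filter, mem_compl, Fin.lt_def, and_congr_right_iff]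
      intro ha
      have : (a : ℕ) ≠ i := fun h => ha (Fin.ext h ▸ hi)
      omega

/-- The set of descents of a permutation. -/
def descents (π : Equiv.Perm (Fin n)) : Finset (Fin n) :=
  {i | ∃ j : Fin n, (j : ℕ) = i + 1 ∧ π j < π i}

theorem card_descents (π : Equiv.Perm (Fin n)) : #(descents π) = des π := by
  rw [des, ← Set.ncard_coe_finset, descents]
  simp

/-- Equal values of a monotone word occupy consecutive positions, so decrease on ties need only be
checked between neighbours. -/
theorem sorts_iff_plateaus {π : Equiv.Perm (Fin n)} {g : Fin n → Fin k} :
    Sorts π g ↔ Monotone (g ∘ π) ∧ plateaus (g ∘ π) ⊆ descents π := by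
  refine and_congr_right fun hm => ?_
  constructor
  · intro h i hi
    rw [plateaus, mem_filter_univ] at hi
    obtain ⟨j, hj, hij⟩ := hi
    rw [descents, mem_filter_univ]
    exact ⟨j, hj, h i j (by rw [Fin.lt_def]; omega) hij.symm⟩
  · intro h i ⟨j, hjn⟩ hij he
    induction j with
    | zero => exact absurd hij (by simp [Fin.lt_def])
    | succ j ih =>
      have hi : (i : ℕ) ≤ j := Nat.lt_succ_iff.1 hij
      have h1 : g (π i) ≤ g (π ⟨j, by omega⟩) := hm hi
      have h2 : g (π ⟨j, by omega⟩) ≤ g (π ⟨j + 1, hjn⟩) := hm (by simp)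
      have h3 : (⟨j, by omega⟩ : Fin n) ∈ descents π := h (by
        rw [plateaus, mem_filter_univ]
        exact ⟨⟨j + 1, hjn⟩, rfl, le_antisymm (he.symm.le.trans h1) h2⟩)
      rw [descents, mem_filter_univ] at h3
      obtain ⟨l, hl, h3⟩ := h3
      obtain rfl : l = ⟨j + 1, hjn⟩ := Fin.ext hl
      rcases hi.eq_or_lt with hi | hi
      · rwa [show i = ⟨j, by omega⟩ from Fin.ext hi]
      · exact h3.trans (ih (by omega) hi (le_antisymm h1 (h2.trans he.symm.le)))

theorem ncard_sorts (π : Equiv.Perm (Fin n)) (hk : k ≤ n) :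
    Set.ncard {g : Fin n → Fin k | Function.Surjective g ∧ Sorts π g} =
      (des π).choose (n - k) := by
  rw [← card_descents, ← card_powersetCard, ← Set.ncard_coe_finset]
  refine Set.ncard_congr (fun g _ => plateaus (g ∘ π)) ?_ ?_ ?_
  · rintro g ⟨hg, hs⟩
    rw [sorts_iff_plateaus] at hs
    rw [mem_coe, mem_powersetCard]
    refine ⟨hs.2, ?_⟩
    have h1 := card_compl_plateaus hs.1 (hg.comp π.surjective)
    have h2 := card_compl_add_card (plateaus (g ∘ π))
    rw [Fintype.card_fin] at h2
    omega
  · rintro g g' ⟨hg, hs⟩ ⟨hg', hs'⟩ h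
    ext a
    obtain ⟨i, rfl⟩ := π.surjective a
    have h1 := val_eq_card_filter hs.1 (hg.comp π.surjective) i
    have h2 := val_eq_card_filter hs'.1 (hg'.comp π.surjective) i
    rw [← h] at h2
    exact h1.trans h2.symm
  · intro S hS
    rw [mem_coe, mem_powersetCard] at hS
    have hS1 (i) (hi : i ∈ S) : (i : ℕ) + 1 < n := by
      have := hS.1 hi
      rw [descents, mem_filter_univ] at this
      obtain ⟨j, hj, -⟩ := this
      omega
    have hS2 : #Sᶜ = k := by
      rw [card_compl, hS.2, Fintype.card_fin]
      omega
    obtain ⟨w, hm, hs, hw⟩ := exists_plateaus_eq hS1 hS2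
    have hwπ : (w ∘ π.symm) ∘ π = w := by
      ext i
      simp
    refine ⟨w ∘ π.symm, ⟨hs.comp π.symm.surjective, ?_⟩, by rw [hwπ, hw]⟩
    rw [sorts_iff_plateaus, hwπ, hw]
    exact ⟨hm, hS.1⟩

-- Partitions are grouped by the permutation that sorts them. The guard k ≤ n matters: for k > n the
-- truncated n - k is 0 and the binomial would be 1.
open Classical in
theorem op_eq_sum (n k : ℕ) : op n k pattern123 =
    ∑ π : Equiv.Perm (Fin n) with ¬ PermContains π pattern123,
      if k ≤ n then (des π).choose (n - k) else 0 := by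
  split_ifs with hk
  · rw [op_eq_ncard, Set.ncard_eq_toFinset_card',
      card_eq_sum_card_fiberwise (f := fun g => Fin.revPerm * Tuple.sort (g ∘ Fin.rev))
        (t := {π : Equiv.Perm (Fin n) | ¬ PermContains π pattern123})]
    · refine sum_congr rfl fun π hπ => ?_
      rw [mem_filter_univ] at hπ
      rw [← ncard_sorts π hk, Set.ncard_eq_toFinset_card']
      congr 1
      ext g
      simp only [mem_filter, Set.mem_toFinset, Set.mem_ofPred_eq]
      rw [eq_comm, ← sorts_iff]
      constructor
      · exact fun h => ⟨h.1.1, h.2⟩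
      · exact fun h => ⟨⟨h.1, by rwa [h.2.avoids_iff]⟩, h.2⟩
    · intro g hg
      simp only [Set.coe_toFinset, Set.mem_ofPred_eq] at hg
      rw [mem_coe, mem_filter_univ, ← (sorts_iff.2 rfl).avoids_iff]
      exact hg.2
  · rw [sum_const_zero, op_eq_ncard, Set.ncard_eq_zero]
    ext g
    simp only [Set.mem_ofPred_eq, Set.mem_empty_iff_false, iff_false]
    rintro ⟨hg, -⟩
    have := Fintype.card_le_of_surjective g hg
    simp only [Fintype.card_fin] at this
    exact hk this

end Words

end OrdPart

-- Solving the functional equations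

namespace OrdPart

open PowerSeries

theorem exists_catalan_root {R : Type*} [CommRing R] (z : PowerSeries R)
    (hz : constantCoeff z = 0) :
    ∃ U : PowerSeries R, constantCoeff U = 1 ∧ U = 1 + z * U ^ 2 := by
  have hs : HasSubst z := HasSubst.of_constantCoeff_zero' hz
  let c : PowerSeries R := map (Nat.castRingHom R) catalanSeries
  have hc : c ^ 2 * X + 1 = c := by
    simpa [c] using congrArg (map (Nat.castRingHom R)) catalanSeries_sq_mul_X_add_one
  have hU : c.subst z = 1 + z * (c.subst z) ^ 2 := by
    have := congrArg (substAlgHom (R := R) hs) hc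
    rw [map_add, map_mul, map_pow, map_one] at this
    simp only [coe_substAlgHom, subst_X hs] at this
    linear_combination -this
  exact ⟨_, by rw [hU]; simp [hz], hU⟩

/-- Power series in the future weights are determined by their functional equations. -/
theorem mk_ext_eq {R : Type*} [CommRing R] {s t : R} {A B : ℕ → PowerSeries R}
    (hA : ∀ m, 1 ≤ m →
      A m = 1 + X * (C s * B (m + 1) + C s * ∑ v ∈ Finset.Ico 1 m, A (v + 1)))
    (hB : ∀ m, 1 ≤ m →
      B m = 1 + X * (C s * B (m + 1) + C t * ∑ v ∈ Finset.Ico 1 m, A (v + 1)))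
    (k m : ℕ) (hm : 1 ≤ m) :
    coeff k (A m) = extA s t k m ∧ coeff k (B m) = extB s t k m := by
  induction k generalizing m with
  | zero =>
    rw [hA m hm, hB m hm]
    simp [extA, extB]
  | succ k ih =>
    have hsum : ∑ v ∈ Finset.Ico 1 m, coeff k (A (v + 1)) =
        ∑ v ∈ Finset.Ico 1 m, extA s t k (v + 1) :=
      Finset.sum_congr rfl fun v _ => (ih (v + 1) (by omega)).1
    rw [hA m hm, hB m hm]
    simp [extA, extB, coeff_one, coeff_succ_X_mul, hsum, (ih (m + 1) (by omega)).2]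

theorem isUnit_of_constantCoeff_eq_one {R : Type*} [CommRing R] {P : PowerSeries R}
    (h : constantCoeff P = 1) : IsUnit P := by
  rw [isUnit_iff_constantCoeff, h]
  exact isUnit_one

/-- The generating function of the weights of the ways to append letters to the permutation of
one letter, in terms of the root `U` of a quadratic equation. -/
theorem mk_extB_two {R : Type*} [CommRing R] {s t : R} (hs : IsUnit s) (hst : s = t + 1)
    {U : PowerSeries R}
    (hU : U = 1 + X * C s * (1 - X) * U ^ 2) :
    C s * (1 - X) * (1 - X * C s * U) * mk (fun k => extB s t k 2) =
      C t * U + (1 - X * C s * U) := by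
  obtain ⟨V, hV⟩ : ∃ V, (1 - X * C s * U) * V = 1 :=
    (isUnit_of_constantCoeff_eq_one (by simp)).exists_right_inv
  obtain ⟨r, hr⟩ := hs.exists_right_inv
  obtain ⟨Q, hQ⟩ : ∃ Q : PowerSeries R, (1 - X) * Q = 1 :=
    (isUnit_of_constantCoeff_eq_one (by simp)).exists_right_inv
  have hr' : (C s * C r : PowerSeries R) = 1 := by rw [← map_mul, hr, map_one]
  have hst' : (C s : PowerSeries R) = C t + 1 := by rw [hst, map_add, map_one]
  -- Differences of the equations in m remove the sums and leave linear recursions, for which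
  -- geometric sequences of ratio U are tried. The quadratic for U makes them compatible, and the
  -- equation at m = 1 fixes the constant part of B. By `mk_ext_eq` any solution is the right one.
  let A : ℕ → PowerSeries R := fun m => U ^ m
  let B : ℕ → PowerSeries R := fun m => (C t * U ^ (m - 1) * V + 1) * C r * Q
  have hsB (m : ℕ) : C s * (1 - X) * B m = C t * U ^ (m - 1) * V + 1 := by
    linear_combination (C t * U ^ (m - 1) * V + 1) * ((1 - X) * Q * hr' + hQ)
  have hcancel {a b : PowerSeries R} (h : C s * (1 - X) * a = C s * (1 - X) * b) : a = b :=
    ((hs.map C).mul (.of_mul_eq_one Q hQ)).mul_left_cancel h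
  have hVU : V * (1 - X * U) = (1 - X) * U := by
    linear_combination (1 - X) * U * hV - V * hU
  have hVt : X * C t * U * V = (1 - X) * U - 1 := by
    linear_combination hVU - hV - X * U * V * hst'
  have hA (m : ℕ) (hm : 1 ≤ m) :
      A m = 1 + X * (C s * B (m + 1) + C s * ∑ v ∈ Finset.Ico 1 m, A (v + 1)) := by
    induction m, hm using Nat.le_induction with
    | base =>
      refine hcancel ?_
      have h := hsB 2
      simp only [A, Finset.Ico_self, Finset.sum_empty, show 2 - 1 = 1 from rfl, pow_one] at h ⊢
      linear_combination -X * C s * h - C s * hVt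
    | succ m hm ih =>
      refine hcancel ?_
      obtain ⟨m, rfl⟩ : ∃ j, m = j + 1 := ⟨m - 1, by omega⟩
      rw [Finset.sum_Ico_succ_top hm]
      have h1 := hsB (m + 1 + 1)
      have h2 := hsB (m + 1 + 1 + 1)
      simp only [A, add_tsub_cancel_right] at h1 h2 ih ⊢
      linear_combination C s * (1 - X) * ih - X * C s * (h2 - h1)
        - C s * U ^ m * (U - 1) * hVt + C s * U ^ m * hU
  have hB (m : ℕ) (hm : 1 ≤ m) :
      B m = 1 + X * (C s * B (m + 1) + C t * ∑ v ∈ Finset.Ico 1 m, A (v + 1)) := by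
    have hA' := hA m hm
    refine hcancel ?_
    obtain ⟨m, rfl⟩ : ∃ j, m = j + 1 := ⟨m - 1, by omega⟩
    have h1 := hsB (m + 1)
    have h2 := hsB (m + 1 + 1)
    simp only [A, add_tsub_cancel_right] at h1 h2 hA' ⊢
    linear_combination h1 - X * (C s - C t) * h2 + C t * (1 - X) * hA'
      - (X * (C t * V * U ^ (m + 1) + 1) + (1 - X)) * hst' + C t * U ^ m * hVU
  have hmk : mk (fun k => extB s t k 2) = B 2 := by
    ext k : 1
    rw [coeff_mk, (mk_ext_eq hA hB k 2 (by omega)).2]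
  rw [hmk]
  have := hsB 2
  rw [show 2 - 1 = 1 from rfl, pow_one] at this
  linear_combination (1 - X * C s * U) * this + C t * U * hV

end OrdPart

-- Assembling both identities

namespace OrdPart

theorem coeff_X_pow_mul_one_add_X_pow {n d : ℕ} (hd : d ≤ n) (k : ℕ) :
    PowerSeries.coeff k ((PowerSeries.X : PowerSeries ℚ) ^ (n - d) * (PowerSeries.X + 1) ^ d) =
      if k ≤ n then (d.choose (n - k) : ℚ) else 0 := by
  have h : (PowerSeries.X + 1 : PowerSeries ℚ) ^ d =
      ((1 + Polynomial.X : Polynomial ℚ) ^ d : Polynomial ℚ) := by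
    rw [add_comm]
    push_cast
    rfl
  rw [h, PowerSeries.coeff_X_pow_mul', Polynomial.coeff_coe, Polynomial.coeff_one_add_X_pow]
  split_ifs with h1 h2 h2
  -- The coefficient counts the k - (n - d) descents that separate blocks; by symmetry it counts the
  -- n - k that do not.
  · rw [← Nat.choose_symm_of_eq_add (show d = (k - (n - d)) + (n - k) by omega)]
  · rw [Nat.choose_eq_zero_of_lt (by omega), Nat.cast_zero]
  · rw [Nat.choose_eq_zero_of_lt (by omega), Nat.cast_zero]
  · rfl

open Classical in
theorem coeff_F (n : ℕ) : PowerSeries.coeff n F =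
    ∑ π : Equiv.Perm (Fin n) with ¬ PermContains π pattern123,
      weight (PowerSeries.X + 1) PowerSeries.X π := by
  ext k
  rw [F, PowerSeries.coeff_mk, PowerSeries.coeff_mk, op_eq_sum, map_sum, Nat.cast_sum]
  refine Finset.sum_congr rfl fun π _ => ?_
  rw [weight, coeff_X_pow_mul_one_add_X_pow (des_le π)]
  split_ifs <;> simp

theorem yL_ne_zero : yL ≠ 0 := HahnSeries.single_ne_zero one_ne_zero

theorem toLaurent_F : toLaurent F = substAt E yL (1 + yL⁻¹) := by
  classical
  ext1 n
  rw [toLaurent, PowerSeries.coeff_map, coeff_F, substAt, PowerSeries.coeff_rescale,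
    PowerSeries.coeff_map, E, PowerSeries.coeff_mk, map_sum, map_sum, Finset.mul_sum]
  refine Finset.sum_congr rfl fun π _ => ?_
  have hX : HahnSeries.ofPowerSeries ℤ ℚ PowerSeries.X = yL := HahnSeries.ofPowerSeries_X
  have hs : yL + 1 = yL * (1 + yL⁻¹) := by
    rw [mul_add, mul_inv_cancel₀ yL_ne_zero, mul_one]
  have he : (Polynomial.aeval (1 + yL⁻¹) : Polynomial ℚ →ₐ[ℚ] LaurentSeries ℚ).toRingHom
      (Polynomial.X ^ des π) = (1 + yL⁻¹) ^ des π := by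
    simp
  rw [he, weight, map_mul, map_pow, map_pow, map_add, map_one, hX, hs, mul_pow, ← mul_assoc,
    ← pow_add, Nat.sub_add_cancel (des_le π)]

/-- The 1 is the empty permutation; the factor xy is the first letter, which is never a descent. -/
theorem F_eq : F = 1 + PowerSeries.X * (PowerSeries.C PowerSeries.X *
    PowerSeries.mk fun k => extB (PowerSeries.X + 1 : PowerSeries ℚ) PowerSeries.X k 2) := by
  classical
  ext1 n
  cases n with
  | zero =>
    have hc (π : Equiv.Perm (Fin 0)) : ¬ PermContains π pattern123 := by
      rw [permContains_pattern123]
      rintro ⟨i, -⟩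
      exact i.elim0
    have hd (π : Equiv.Perm (Fin 0)) : des π = 0 := Nat.le_zero.1 (des_le π)
    rw [coeff_F]
    simp [hc, hd, weight]
  | succ n =>
    rw [coeff_F, sum_weight, map_add, PowerSeries.coeff_succ_X_mul, PowerSeries.coeff_C_mul,
      PowerSeries.coeff_mk]
    simp [PowerSeries.coeff_one]

theorem two_powerSeries_ne_zero {R : Type*} [CommSemiring R] [NeZero (2 : R)] :
    (2 : PowerSeries R) ≠ 0 := fun h => two_ne_zero (α := R) (by
  simpa only [map_ofNat, map_zero] using congrArg PowerSeries.constantCoeff h)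

instance : NeZero (2 : PowerSeries ℚ) := ⟨two_powerSeries_ne_zero⟩

theorem IsFormalSqrt.unique {P S S' : PowerSeries (PowerSeries ℚ)} (h : IsFormalSqrt P S)
    (h' : IsFormalSqrt P S') : S' = S := by
  rcases sq_eq_sq_iff_eq_or_eq_neg.1 (h'.2.trans h.2.symm) with e | e
  · exact e
  · have := h'.1
    rw [e, map_neg, h.1, neg_eq_iff_add_eq_zero, one_add_one_eq_two] at this
    exact absurd this two_powerSeries_ne_zero

theorem denominator_ne_zero : 2 * x * (y + 1) ^ 2 * (x - 1) ≠ 0 := by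
  have hx : x ≠ 0 := PowerSeries.X_ne_zero
  have hx1 : x - 1 ≠ 0 := fun h => by
    have := congrArg PowerSeries.constantCoeff h
    simp [x] at this
  have hy : y + 1 ≠ 0 := fun h => by
    have := congrArg (fun p => PowerSeries.constantCoeff (PowerSeries.constantCoeff p)) h
    simp [y] at this
  exact mul_ne_zero (mul_ne_zero (mul_ne_zero two_powerSeries_ne_zero hx) (pow_ne_zero 2 hy)) hx1

/-- The closed form, with denominators cleared. -/
theorem exists_isFormalSqrt : ∃ S : PowerSeries (PowerSeries ℚ),
    IsFormalSqrt (1 - 4 * x * y - 4 * x + 4 * x ^ 2 * y + 4 * x ^ 2) S ∧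
      F * (2 * x * (y + 1) ^ 2 * (x - 1)) =
        -y - 2 * x * y - 2 * x + 2 * x ^ 2 * y + 2 * x ^ 2 + y * S := by
  obtain ⟨U, hU1, hU⟩ := exists_catalan_root (x * (y + 1) * (1 - x)) (by simp [x])
  have hy : (PowerSeries.C (PowerSeries.X + 1 : PowerSeries ℚ)) = y + 1 := by
    rw [map_add, map_one]; rfl
  have hs : IsUnit (PowerSeries.X + 1 : PowerSeries ℚ) :=
    isUnit_of_constantCoeff_eq_one (by simp)
  have hB := mk_extB_two hs rfl (U := U) (by rw [hy]; exact hU)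
  have hF := F_eq
  generalize (PowerSeries.mk fun k =>
    extB (PowerSeries.X + 1 : PowerSeries ℚ) PowerSeries.X k 2) = B at hB hF
  rw [hy] at hB
  change F = 1 + x * (y * B) at hF
  change (y + 1) * (1 - x) * (1 - x * (y + 1) * U) * B = y * U + (1 - x * (y + 1) * U) at hB
  -- With z = x(y + 1)(1 - x), the root of U = 1 + zU² with constant term 1 is (1 - √(1 - 4z)) /
  -- (2z), so √(1 - 4z) = 1 - 2zU.
  refine ⟨1 - 2 * x * (y + 1) * (1 - x) * U, ⟨by simp [x], ?_⟩, ?_⟩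
  · linear_combination -4 * x * (y + 1) * (1 - x) * hU
  · have hD : IsUnit (1 - x * (y + 1) * U) := isUnit_of_constantCoeff_eq_one (by simp [x])
    refine hD.mul_left_cancel ?_
    rw [hF]
    linear_combination -2 * x ^ 2 * y * (y + 1) * hB + 2 * x * y * (y + 1) * hU

end OrdPart

theorem mainTheorem2 :
    -- `F(x, y) = E(x y, 1 + 1 / y)`, an identity in `ℚ((y))[[x]]`
    OrdPart.toLaurent OrdPart.F
        = OrdPart.substAt OrdPart.E OrdPart.yL (1 + OrdPart.yL⁻¹) ∧
    -- the closed form, with `S = √(1 - 4xy - 4x + 4x²y + 4x²)`, in the field of fractions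
    ∃ S : PowerSeries (PowerSeries ℚ),
      OrdPart.IsFormalSqrt
        (1 - 4 * OrdPart.x * OrdPart.y - 4 * OrdPart.x
          + 4 * OrdPart.x ^ 2 * OrdPart.y + 4 * OrdPart.x ^ 2) S ∧
      (∀ S' : PowerSeries (PowerSeries ℚ),
        OrdPart.IsFormalSqrt
          (1 - 4 * OrdPart.x * OrdPart.y - 4 * OrdPart.x
            + 4 * OrdPart.x ^ 2 * OrdPart.y + 4 * OrdPart.x ^ 2) S' → S' = S) ∧
      2 * OrdPart.x * (OrdPart.y + 1) ^ 2 * (OrdPart.x - 1) ≠ 0 ∧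
      OrdPart.toFrac OrdPart.F
        = OrdPart.toFrac (-OrdPart.y - 2 * OrdPart.x * OrdPart.y - 2 * OrdPart.x
            + 2 * OrdPart.x ^ 2 * OrdPart.y + 2 * OrdPart.x ^ 2 + OrdPart.y * S)
          / OrdPart.toFrac (2 * OrdPart.x * (OrdPart.y + 1) ^ 2 * (OrdPart.x - 1)) := by
  obtain ⟨S, hS, hF⟩ := OrdPart.exists_isFormalSqrt
  refine ⟨OrdPart.toLaurent_F, S, hS, fun S' hS' => hS.unique hS',
    OrdPart.denominator_ne_zero, ?_⟩
  rw [eq_div_iff, ← map_mul, hF]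
  rw [OrdPart.toFrac]
  exact (map_ne_zero_iff _ (IsFractionRing.injective _ _)).2 OrdPart.denominator_ne_zero
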